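/- Let $(R,\mathfrak m)$ be a one-dimensional Cohen–Macaulay (Noetherian) local ring with infinite residue field, let $s\ge 1$, and let $I_1,\dots,I_s$ be $\mathfrak m$-primary ideals of $R$. Order $\mathbb Z^s$ componentwise and put $e=(1,\dots,1)\in\mathbb Z^s$; for $\underline n\in\mathbb Z^s$ let $\underline n^+$ have components $\max(n_i,0)$ and put $\underline I^{\underline n}=I_1^{n_1}\cdots I_s^{n_s}$, where $I_i^{k}=R$ for $k\le 0$. "For all large $\underline n$" means for all $\underline n\ge \underline N$ for some $\underline N\in\mathbb N^s$. Let $\mathcal F=\{\mathcal F(\underline n)\}_{\underline n\in\mathbb Z^s}$ be an $(I_1,\dots,I_s)$-admissible filtration of ideals of $R$: for all $\underline m,\underline n\in\mathbb Z^s$ one has $\underline I^{\underline n}\subseteq\mathcal F(\underline n)$, $\mathcal F(\underline m)\mathcal F(\underline n)\subseteq\mathcal F(\underline m+\underline n)$, $\mathcal F(\underline m)\subseteq\mathcal F(\underline n)$ whenever $\underline m\ge\underline n$, and $\mathcal F(\underline n)=\mathcal F(\underline n^+)$; and the extended Rees ring $\bigoplus_{\underline n\in\mathbb Z^s}\mathcal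 F(\underline n)\underline t^{\underline n}$ is a finite module over $\bigoplus_{\underline n\in\mathbb Z^s}\underline I^{\underline n}\underline t^{\underline n}$. Let $H_{\mathcal F}(\underline n)=\lambda(R/\mathcal F(\underline n))$ be the Hilbert function of $\mathcal F$ ($\lambda$ denotes length), and let $P_{\mathcal F}$ be its Hilbert polynomial, i.e. the polynomial $P_{\mathcal F}(\underline n)=\sum_{|\alpha|\le 1}(-1)^{1-|\alpha|}e_\alpha\prod_{i=1}^s\binom{n_i+\alpha_i-1}{\alpha_i}$ with $\alpha\in\mathbb N^s$, $e_\alpha\in\mathbb Z$, which equals $H_{\mathcal F}(\underline n)$ for all large $\underline n$. A vector $\underline n\in\mathbb Z^s$ is a postulation vector of $\mathcal F$ if $H_{\mathcal F}(\underline m)=P_{\mathcal F}(\underline m)$ for all $\underline m\ge\underline n$; let $\mathcal P(\mathcal F)\subseteq\mathbb Z^s$ be the set of postulation vectors. A complete reduction of $\mathcal F$ is a family $\mathcal A=\{a_i\in I_i: i=1,\dots,s\}$ such that, with $J=(a_1\cdots a_s)$, $J\mathcal F(\underline n)=\mathcal F(\underline n+e)$ for all large $\underline n$. A vector $\underline r\in\mathbb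 N^s$ is a reduction vector of $\mathcal F$ with respect to $\mathcal A$ if $J\mathcal F(\underline n)=\mathcal F(\underline n+e)$ for all $\underline n\ge\underline r$; let $\mathcal R_{\mathcal A}(\mathcal F)$ be the set of these vectors. Let $\mathcal A$ be a complete reduction of $\mathcal F$. Then $$\mathcal P(\mathcal F)\subseteq\mathbb N^s\qquad\text{and}\qquad \mathcal P(\mathcal F)=\mathcal R_{\mathcal A}(\mathcal F).$$ Moreover, $\mathcal R_{\mathcal A}(\mathcal F)$ does not depend on the complete reduction: $\mathcal R_{\mathcal A'}(\mathcal F)=\mathcal R_{\mathcal A}(\mathcal F)$ for every complete reduction $\mathcal A'$ of $\mathcal F$. -/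

import Mathlib

open IsLocalRing Filter

/-- A Noetherian local ring is Cohen–Macaulay if its maximal ideal contains an `R`-regular
sequence whose length is the Krull dimension of `R` (that is, `depth R = dim R`). -/
def IsCohenMacaulayLocal (R : Type*) [CommRing R] [IsLocalRing R] : Prop :=
  IsNoetherianRing R ∧ ∃ rs : List R, (∀ r ∈ rs, r ∈ maximalIdeal R) ∧
    RingTheory.Sequence.IsRegular R rs ∧ ringKrullDim R = (rs.length : WithBot ℕ∞)

section Filtrations

variable {R : Type*} [CommRing R] {s : ℕ}

/-- `I₁^{n₁} ⋯ I_s^{n_s}` for `n ∈ ℤ^s`, with the convention `I^k = R` for `k ≤ 0`. -/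
def idealPow (I : Fin s → Ideal R) (n : Fin s → ℤ) : Ideal R :=
  ∏ i, I i ^ (n i).toNat

/-- A `ℤ^s`-graded `(I₁, …, I_s)`-filtration of ideals. The order on `Fin s → ℤ` is the
componentwise one. -/
structure MultiFiltration (I : Fin s → Ideal R) where
  ideal : (Fin s → ℤ) → Ideal R
  pow_le : ∀ n, idealPow I n ≤ ideal n
  mul_le : ∀ m n, ideal m * ideal n ≤ ideal (m + n)
  anti : ∀ m n, n ≤ m → ideal m ≤ ideal n

lemma idealPow_mul_le (I : Fin s → Ideal R) (m n : Fin s → ℤ) :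
    idealPow I m * idealPow I n ≤ idealPow I (m + n) := by
  unfold idealPow
  rw [← Finset.prod_mul_distrib]
  refine Finset.prod_le_prod' fun i _ => ?_
  rw [← pow_add]
  exact Ideal.pow_le_pow_right (by simp only [Pi.add_apply]; omega)

lemma idealPow_anti (I : Fin s → Ideal R) (m n : Fin s → ℤ) (h : n ≤ m) :
    idealPow I m ≤ idealPow I n := by
  unfold idealPow
  refine Finset.prod_le_prod' fun i _ => ?_
  exact Ideal.pow_le_pow_right (Int.toNat_le_toNat (h i))

/-- The filtration `{I^n}` itself. -/
def adicMultiFiltration (I : Fin s → Ideal R) : MultiFiltration I where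
  ideal := idealPow I
  pow_le _ := le_rfl
  mul_le := idealPow_mul_le I
  anti := idealPow_anti I

namespace MultiFiltration

variable {I : Fin s → Ideal R}

lemma one_mem_ideal_zero (F : MultiFiltration I) : (1 : R) ∈ F.ideal 0 :=
  F.pow_le 0 <| by
    have h : idealPow I 0 = 1 := Finset.prod_eq_one fun i _ => by simp
    rw [h, Ideal.one_eq_top]
    exact Submodule.mem_top

/-- The extended Rees ring `⨁_{n ∈ ℤ^s} F(n) t^n`, as a subalgebra of the Laurent polynomial
ring `R[t₁^{±1}, …, t_s^{±1}] = R[ℤ^s]`. -/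
def extendedRees (F : MultiFiltration I) : Subalgebra R (AddMonoidAlgebra R (Fin s → ℤ)) where
  carrier := {f | ∀ n, f.coeff n ∈ F.ideal n}
  add_mem' hf hg n := (F.ideal n).add_mem (hf n) (hg n)
  mul_mem' {f g} hf hg n := by
    classical
    rw [AddMonoidAlgebra.coeff_mul]
    refine Ideal.sum_mem _ fun a _ => Ideal.sum_mem _ fun b _ => ?_
    dsimp only
    split_ifs with h
    · subst h
      exact F.mul_le a b (Ideal.mul_mem_mul (hf a) (hg b))
    · exact zero_mem _
  algebraMap_mem' r n := by
    classical
    by_cases h : n = 0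
    · subst h
      have := (F.ideal 0).mul_mem_left r F.one_mem_ideal_zero
      simpa using this
    · simp [Ne.symm h]

lemma adic_extendedRees_le (F : MultiFiltration I) :
    (adicMultiFiltration I).extendedRees ≤ F.extendedRees :=
  fun _ hf n => F.pow_le n (hf n)

/-- `F` is `I`-admissible: `F(n) = F(n⁺)` for all `n ∈ ℤ^s`, and the extended Rees ring of `F` is
a finite module over the extended Rees ring of `{I^n}`. -/
def IsAdmissible (F : MultiFiltration I) : Prop :=
  (∀ n, F.ideal n = F.ideal (n ⊔ 0)) ∧
    (Subalgebra.inclusion F.adic_extendedRees_le).toRingHom.Finite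

/-- The Hilbert function `H_F(n) = λ(R / F(n))`. When `R` is Noetherian local and the `I_i` are
primary to the maximal ideal, this length is finite, since `F(n) ⊇ I^n`. -/
noncomputable def hilbertFunction (F : MultiFiltration I) (n : Fin s → ℤ) : ℤ :=
  ((Module.length R (R ⧸ F.ideal n)).toNat : ℤ)

/-- The polynomial function on `ℤ^s`
`∑_{|α| ≤ d} (-1)^{d-|α|} e_α binom(n₁+α₁-1, α₁) ⋯ binom(n_s+α_s-1, α_s)`
with integer coefficients `e_α`. -/
noncomputable def binomialPolynomial (d : ℕ) (e : (Fin s → ℕ) → ℤ) (n : Fin s → ℤ) : ℤ :=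
  ∑ α ∈ (Fintype.piFinset fun _ : Fin s => Finset.range (d + 1)) with ∑ i, α i ≤ d,
    (-1) ^ (d - ∑ i, α i) * e α * ∏ i, Ring.choose (n i + (α i : ℤ) - 1) (α i)

/-- `P` is the Hilbert polynomial of `F`: a polynomial function of the above form, with
`d = dim R`, which agrees with the Hilbert function for all large `n` (this determines `P`). -/
def IsHilbertPolynomial (F : MultiFiltration I) (P : (Fin s → ℤ) → ℤ) : Prop :=
  (∃ d : ℕ, ringKrullDim R = (d : WithBot ℕ∞) ∧ ∃ e, P = binomialPolynomial d e) ∧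
    ∀ᶠ n in atTop, P n = F.hilbertFunction n

/-- The set of postulation vectors: all `n ∈ ℤ^s` with `H_F(m) = P_F(m)` for all `m ≥ n`. -/
def postulationVectors (F : MultiFiltration I) : Set (Fin s → ℤ) :=
  {n | ∃ P, F.IsHilbertPolynomial P ∧ ∀ m, n ≤ m → F.hilbertFunction m = P m}

end MultiFiltration

/-- The ideal `(y₁, …, y_d)` with `y_j = x_{1j} ⋯ x_{sj}`. -/
def columnProductIdeal {d : ℕ} (x : Fin s → Fin d → R) : Ideal R :=
  Ideal.span (Set.range fun j => ∏ i, x i j)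

namespace MultiFiltration

variable {I : Fin s → Ideal R}

/-- A family `x_{ij} ∈ I_i`, `j = 1, …, d`, is a complete reduction of `F` if
`(y₁, …, y_d) F(n) = F(n + (1, …, 1))` for all large `n`. The number `d` of columns is to be the
dimension of `R`. -/
def IsCompleteReduction (F : MultiFiltration I) {d : ℕ} (x : Fin s → Fin d → R) : Prop :=
  (∀ i j, x i j ∈ I i) ∧
    ∀ᶠ n in atTop, columnProductIdeal x * F.ideal n = F.ideal (n + 1)

/-- The set of reduction vectors of `F` with respect to `x`: all `r ∈ ℕ^s` such that
`(y₁, …, y_d) F(n) = F(n + (1, …, 1))` for all `n ≥ r`. -/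
def reductionVectors (F : MultiFiltration I) {d : ℕ} (x : Fin s → Fin d → R) :
    Set (Fin s → ℤ) :=
  {r | 0 ≤ r ∧ ∀ n, r ≤ n → columnProductIdeal x * F.ideal n = F.ideal (n + 1)}

end MultiFiltration

end Filtrations

/-! ### Colength of principal multiples of an ideal. -/

section Colength

open scoped Pointwise

variable {R : Type*} [CommRing R]

/-! Put a = a₁⋯a_s, a nonzerodivisor. Since λ(R/aK) = λ(R/K) + λ(R/a) and aF(n) ⊆ F(n+e), equality
aF(n) = F(n+e) is the numerical condition H(n+e) = H(n) + λ(R/a) (`span_prod_mul_ideal_eq_iff`). The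
polynomial P is affine and satisfies P(n+e) = P(n) + λ(R/a) everywhere, so H = P beyond r gives the
condition beyond r; conversely, the condition makes H - P constant along diagonals, where it is
eventually 0. Nonnegativity holds because F ignores negative coordinates while P has slope λ(R/aᵢ) >
0 in direction i. Independence of the reduction follows because postulation vectors do not involve
it. -/

lemma Ideal.length_quotient_span_singleton_mul {a : R} (ha : a ∈ nonZeroDivisors R)
    (K : Ideal R) :
    Module.length R (R ⧸ Ideal.span {a} * K) =
      Module.length R (R ⧸ K) + Ring.ord R a := by
  have h : Ideal.span {a} * K = a • K := by
    ext x
    rw [Ideal.mem_span_singleton_mul, Submodule.mem_smul_pointwise_iff_exists]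
    simp
  rw [h]
  -- Length is additive on 0 → R/K → R/aK → R/a → 0, whose first map is multiplication by a.
  exact Module.length_eq_add_of_exact (Ideal.mulQuot a K) (Ideal.quotOfMul a K)
    (Ideal.mulQuot_injective K ha) (Ideal.quotOfMul_surjective K)
    (Ideal.exact_mulQuot_quotOfMul K)

lemma Ideal.eq_of_le_of_length_quotient_eq {K L : Ideal R} (hle : K ≤ L)
    (hfin : Module.length R (R ⧸ L) ≠ ⊤)
    (h : Module.length R (R ⧸ K) = Module.length R (R ⧸ L)) : K = L := by
  by_contra hne
  rw [Module.length_quotient] at hfin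
  rw [Module.length_quotient, Module.length_quotient] at h
  exact (Order.coheight_strictAnti (lt_of_le_of_ne hle hne) hfin.lt_top).ne' h

lemma exists_mem_nonZeroDivisors_of_isCohenMacaulayLocal [IsLocalRing R]
    (hCM : IsCohenMacaulayLocal R) (hdim : ringKrullDim R = 1) :
    ∃ x ∈ maximalIdeal R, x ∈ nonZeroDivisors R := by
  obtain ⟨-, rs, hmem, hreg, hlen⟩ := hCM
  rw [hdim] at hlen
  have h1 : rs.length = 1 := by exact_mod_cast hlen.symm
  obtain ⟨x, rfl⟩ := List.length_eq_one_iff.mp h1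
  refine ⟨x, hmem x (by simp), ?_⟩
  have hx := (RingTheory.Sequence.isWeaklyRegular_singleton_iff R x).mp hreg.toIsWeaklyRegular
  rw [mem_nonZeroDivisors_iff_right]
  intro z hz
  exact hx (by simpa [mul_comm] using hz)

end Colength

/-! ### Integer affine functions and binomial polynomials of degree at most one. -/

section AffineFunctions

variable {s : ℕ}

lemma filter_sum_le_one_eq :
    (Fintype.piFinset fun _ : Fin s => Finset.range 2).filter (fun α => ∑ i, α i ≤ 1) =
      insert 0 (Finset.univ.image fun i : Fin s => (Pi.single i 1 : Fin s → ℕ)) := by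
  ext α
  simp only [Finset.mem_filter, Fintype.mem_piFinset, Finset.mem_range, Finset.mem_insert,
    Finset.mem_image, Finset.mem_univ, true_and]
  constructor
  · rintro ⟨-, hα⟩
    by_cases h0 : α = 0
    · exact Or.inl h0
    · obtain ⟨i, hi⟩ := Function.ne_iff.mp h0
      refine Or.inr ⟨i, ?_⟩
      have hsum := Finset.add_sum_erase Finset.univ α (Finset.mem_univ i)
      have hi' : α i ≠ 0 := hi
      have hrest : ∑ j ∈ Finset.univ.erase i, α j = 0 := by omega
      funext j
      by_cases hj : j = i
      · subst hj
        rw [Pi.single_eq_same]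
        omega
      · rw [Pi.single_eq_of_ne hj]
        exact ((Finset.sum_eq_zero_iff.mp hrest) j (by simp [hj])).symm
  · rintro (rfl | ⟨i, rfl⟩)
    · simp
    · refine ⟨fun j => ?_, by simp⟩
      by_cases hj : j = i
      · subst hj; simp
      · simp [hj]

lemma MultiFiltration.binomialPolynomial_one (e : (Fin s → ℕ) → ℤ) (n : Fin s → ℤ) :
    MultiFiltration.binomialPolynomial 1 e n = -e 0 + ∑ i, e (Pi.single i 1) * n i := by
  have hprod (i : Fin s) : ∏ j, Ring.choose (n j + ((Pi.single i 1 : Fin s → ℕ) j : ℤ) - 1)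
      ((Pi.single i 1 : Fin s → ℕ) j) = n i := by
    rw [Finset.prod_eq_single i]
    · simp
    · intro j _ hj
      simp [hj]
    · simp
  unfold MultiFiltration.binomialPolynomial
  rw [filter_sum_le_one_eq, Finset.sum_insert, Finset.sum_image]
  · congr 1
    · simp
    · refine Finset.sum_congr rfl fun i _ => ?_
      rw [hprod]
      simp
  · intro i _ j _ h
    by_contra hij
    have := congrFun h i
    simp [hij] at this
  · simp only [Finset.mem_image, Finset.mem_univ, true_and, not_exists]
    intro i h
    simpa using congrFun h i

lemma MultiFiltration.exists_binomialPolynomial_one_eq (c₀ : ℤ) (c : Fin s → ℤ) :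
    ∃ e, ∀ n, MultiFiltration.binomialPolynomial 1 e n = c₀ + ∑ i, c i * n i := by
  -- The sign (-1)^(1-|α|) negates the constant coefficient; at α = eᵢ the sum is cᵢ.
  refine ⟨fun α => if α = 0 then -c₀ else ∑ i, c i * α i, fun n => ?_⟩
  rw [binomialPolynomial_one, if_pos rfl, neg_neg]
  congr 1
  refine Finset.sum_congr rfl fun i _ => ?_
  rw [if_neg (by simp), Finset.sum_eq_single i]
  · simp
  · intro j _ hj
    simp [hj]
  · simp

/-- A function on `ℤ^s` with constant first differences beyond `N` is affine beyond `N`. -/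
lemma eq_affine_of_add_single {H : (Fin s → ℤ) → ℤ} {N c : Fin s → ℤ}
    (hH : ∀ n, N ≤ n → ∀ i, H (n + Pi.single i 1) = H n + c i) {n : Fin s → ℤ} (hn : N ≤ n) :
    H n = H N + ∑ i, c i * (n i - N i) := by
  have step (i : Fin s) (m : Fin s → ℤ) (hm : N ≤ m) (k : ℕ) :
      H (m + Pi.single i (k : ℤ)) = H m + c i * k := by
    induction k with
    | zero => simp
    | succ k ih =>
      have hle : N ≤ m + Pi.single i (k : ℤ) :=
        hm.trans (le_add_of_nonneg_right (Pi.single_nonneg.mpr (by positivity)))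
      have := hH _ hle i
      rw [add_assoc, ← Pi.single_add, ih] at this
      push_cast
      rw [this]
      ring
  -- Walk from N to n one coordinate at a time, never leaving the region above N.
  have key (T : Finset (Fin s)) :
      H (N + ∑ i ∈ T, Pi.single i ((n i - N i).toNat : ℤ)) =
        H N + ∑ i ∈ T, c i * ((n i - N i).toNat : ℤ) := by
    classical
    induction T using Finset.induction_on with
    | empty => simp
    | insert i T hi ih =>
      rw [Finset.sum_insert hi, Finset.sum_insert hi, add_comm (Pi.single i _), ← add_assoc,
        step, ih]
      · ring
      · exact le_add_of_nonneg_right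
          (Finset.sum_nonneg fun j _ => Pi.single_nonneg.mpr (by positivity))
  have hcast (i : Fin s) : ((n i - N i).toNat : ℤ) = n i - N i :=
    Int.toNat_of_nonneg (sub_nonneg.mpr (hn i))
  have hsum := key Finset.univ
  simp only [hcast] at hsum
  rwa [Finset.univ_sum_single (fun i => n i - N i),
    show N + (fun i => n i - N i) = n by funext i; simp] at hsum

end AffineFunctions

/-! ### Filtrations in dimension one: finiteness, reductions, Hilbert polynomial. -/

namespace MultiFiltration

variable {R : Type*} [CommRing R] {s : ℕ} {I : Fin s → Ideal R}

lemma exists_pow_mem_ideal (F : MultiFiltration I) {x : R} (hx : ∀ i, x ∈ (I i).radical)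
    (n : Fin s → ℤ) : ∃ k : ℕ, x ^ k ∈ F.ideal n := by
  choose k hk using hx
  refine ⟨∑ i, k i * (n i).toNat, F.pow_le n ?_⟩
  rw [← Finset.prod_pow_eq_pow_sum]
  refine Ideal.prod_mem_prod fun i _ => ?_
  rw [pow_mul]
  exact Ideal.pow_mem_pow (hk i) _

lemma length_quotient_ideal_ne_top [IsNoetherianRing R] [Ring.KrullDimLE 1 R]
    (F : MultiFiltration I) {x : R} (hreg : x ∈ nonZeroDivisors R)
    (hx : ∀ i, x ∈ (I i).radical) (n : Fin s → ℤ) :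
    Module.length R (R ⧸ F.ideal n) ≠ ⊤ := by
  obtain ⟨k, hk⟩ := F.exists_pow_mem_ideal hx n
  have hle : Ideal.span {x ^ k} ≤ F.ideal n := (Ideal.span_singleton_le_iff_mem _).mpr hk
  exact ((Module.length_le_of_surjective _ (Submodule.factor_surjective hle)).trans_lt
    (Ring.ord_lt_top (pow_mem hreg k))).ne

lemma columnProductIdeal_fin_one (A : Fin s → Fin 1 → R) :
    columnProductIdeal A = Ideal.span {∏ i, A i 0} := by
  simp [columnProductIdeal, Set.range_unique]

section Rows

variable (F : MultiFiltration I) {A : Fin s → Fin 1 → R}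

/-- A power of x lies in F(N+e) = aF(N), so a divides a nonzerodivisor. -/
lemma prod_mem_nonZeroDivisors (hA : F.IsCompleteReduction A) {x : R}
    (hreg : x ∈ nonZeroDivisors R) (hx : ∀ i, x ∈ (I i).radical) :
    ∏ i, A i 0 ∈ nonZeroDivisors R := by
  obtain ⟨N, hN⟩ := eventually_atTop.mp hA.2
  obtain ⟨k, hk⟩ := F.exists_pow_mem_ideal hx (N + 1)
  rw [← hN N le_rfl, columnProductIdeal_fin_one, Ideal.mem_span_singleton_mul] at hk
  obtain ⟨r, -, hr⟩ := hk
  have hpow : (∏ i, A i 0) * r ∈ nonZeroDivisors R := by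
    rw [hr]
    exact pow_mem hreg k
  exact (mul_mem_nonZeroDivisors.mp hpow).1

lemma span_prod_mul_ideal_le (hA : ∀ i, A i 0 ∈ I i) (n : Fin s → ℤ) :
    Ideal.span {∏ i, A i 0} * F.ideal n ≤ F.ideal (n + 1) := by
  rw [add_comm]
  refine le_trans (Ideal.mul_mono_left ?_) (F.mul_le 1 n)
  rw [Ideal.span_singleton_le_iff_mem]
  refine F.pow_le 1 (Ideal.prod_mem_prod fun i _ => ?_)
  simpa using hA i

/-- For a complete reduction `(a_i)`, also `a_i F(n) = F(n + e_i)` for all large `n`. -/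
lemma eventually_span_mul_ideal_eq (hA : F.IsCompleteReduction A) :
    ∀ᶠ n in atTop, ∀ i, Ideal.span {A i 0} * F.ideal n = F.ideal (n + Pi.single i 1) := by
  classical
  obtain ⟨N, hN⟩ := eventually_atTop.mp hA.2
  refine eventually_atTop.mpr ⟨N + 1, fun n hn i => le_antisymm ?_ ?_⟩
  · rw [add_comm]
    refine le_trans (Ideal.mul_mono_left ?_) (F.mul_le _ n)
    rw [Ideal.span_singleton_le_iff_mem]
    refine F.pow_le _ ?_
    rw [idealPow, Finset.prod_eq_single i]
    · simpa using hA.1 i 0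
    · intro j _ hj
      simp [hj]
    · simp
  -- With u = e - eᵢ, the product of the other aⱼ lies in F(u), so F(n+eᵢ) = aF(n-u) ⊆ aᵢF(u)F(n-u)
  -- ⊆ aᵢF(n). The threshold N+1 ensures n-u ≥ N.
  · set u : Fin s → ℤ := 1 - Pi.single i 1 with hu
    have hle : N ≤ n - u := by
      intro j
      have := hn j
      by_cases hj : j = i
      · subst hj
        simp [hu] at this ⊢
        omega
      · simp [hu, hj] at this ⊢
        omega
    have hmem : ∏ j ∈ Finset.univ.erase i, A j 0 ∈ F.ideal u := by
      refine F.pow_le u ?_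
      rw [idealPow, ← Finset.mul_prod_erase Finset.univ _ (Finset.mem_univ i)]
      simp only [hu, Pi.sub_apply, Pi.one_apply, Pi.single_eq_same, sub_self, Int.toNat_zero,
        pow_zero, one_mul]
      refine Ideal.prod_mem_prod fun j hj => ?_
      simpa [Finset.ne_of_mem_erase hj] using hA.1 j 0
    have h := hN _ hle
    rw [columnProductIdeal_fin_one, ← Finset.mul_prod_erase Finset.univ _ (Finset.mem_univ i),
      ← Ideal.span_singleton_mul_span_singleton, mul_assoc,
      show n - u + 1 = n + Pi.single i 1 by rw [hu]; abel] at h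
    rw [← h]
    refine Ideal.mul_mono_right ?_
    calc _ ≤ F.ideal u * F.ideal (n - u) :=
          Ideal.mul_mono_left ((Ideal.span_singleton_le_iff_mem _).mpr hmem)
      _ ≤ F.ideal n := by simpa using F.mul_le u (n - u)

end Rows

lemma toNat_length_quotient_span_singleton_mul [IsNoetherianRing R] [Ring.KrullDimLE 1 R]
    {a : R} (ha : a ∈ nonZeroDivisors R) {K : Ideal R} (hK : Module.length R (R ⧸ K) ≠ ⊤) :
    (Module.length R (R ⧸ Ideal.span {a} * K)).toNat =
      (Module.length R (R ⧸ K)).toNat + (Ring.ord R a).toNat := by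
  rw [Ideal.length_quotient_span_singleton_mul ha, ENat.toNat_add hK (Ring.ord_ne_top ha)]

section HilbertPolynomial

variable (F : MultiFiltration I) {P : (Fin s → ℤ) → ℤ}

lemma IsHilbertPolynomial.exists_affine (hdim : ringKrullDim R = 1)
    (hP : F.IsHilbertPolynomial P) : ∃ (c₀ : ℤ) (c : Fin s → ℤ), ∀ n, P n = c₀ + ∑ i, c i * n i := by
  obtain ⟨⟨d, hd, e, rfl⟩, -⟩ := hP
  obtain rfl : d = 1 := by
    rw [hdim] at hd
    exact_mod_cast hd.symm
  exact ⟨_, _, binomialPolynomial_one e⟩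

/-- The first differences of the Hilbert polynomial are those of the Hilbert function at large
arguments. -/
lemma IsHilbertPolynomial.add_eq (hdim : ringKrullDim R = 1) (hP : F.IsHilbertPolynomial P)
    {v : Fin s → ℤ} (hv : 0 ≤ v) {l : ℤ}
    (h : ∀ᶠ n in atTop, F.hilbertFunction (n + v) = F.hilbertFunction n + l) (n : Fin s → ℤ) :
    P (n + v) = P n + l := by
  obtain ⟨c₀, c, hc⟩ := hP.exists_affine F hdim
  have hdiff (m : Fin s → ℤ) : P (m + v) = P m + ∑ i, c i * v i := by
    simp only [hc, Pi.add_apply, mul_add, Finset.sum_add_distrib, add_assoc]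
  obtain ⟨N, hN⟩ := eventually_atTop.mp (hP.2.and h)
  have h0 := hdiff N
  rw [(hN N le_rfl).1, (hN (N + v) (le_add_of_nonneg_right hv)).1, (hN N le_rfl).2] at h0
  rw [hdiff n, ← add_left_cancel h0]

end HilbertPolynomial

section CompleteReduction

variable [IsNoetherianRing R] [Ring.KrullDimLE 1 R] (F : MultiFiltration I)
  {A : Fin s → Fin 1 → R}

lemma eventually_hilbertFunction_add_single (hA : F.IsCompleteReduction A) {x : R}
    (hreg : x ∈ nonZeroDivisors R) (hx : ∀ i, x ∈ (I i).radical) :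
    ∀ᶠ n in atTop, ∀ i, F.hilbertFunction (n + Pi.single i 1) =
      F.hilbertFunction n + ((Ring.ord R (A i 0)).toNat : ℤ) := by
  filter_upwards [F.eventually_span_mul_ideal_eq hA] with n hn i
  have hi : A i 0 ∈ nonZeroDivisors R := by
    have := F.prod_mem_nonZeroDivisors hA hreg hx
    rw [← Finset.mul_prod_erase Finset.univ _ (Finset.mem_univ i)] at this
    exact (mul_mem_nonZeroDivisors.mp this).1
  rw [hilbertFunction, hilbertFunction, ← hn i, toNat_length_quotient_span_singleton_mul hi
    (F.length_quotient_ideal_ne_top hreg hx n), Nat.cast_add]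

lemma exists_isHilbertPolynomial (hdim : ringKrullDim R = 1) (hA : F.IsCompleteReduction A) {x : R}
    (hreg : x ∈ nonZeroDivisors R) (hx : ∀ i, x ∈ (I i).radical) :
    ∃ P, F.IsHilbertPolynomial P := by
  obtain ⟨N, hN⟩ := eventually_atTop.mp (F.eventually_hilbertFunction_add_single hA hreg hx)
  set c : Fin s → ℤ := fun i => ((Ring.ord R (A i 0)).toNat : ℤ)
  obtain ⟨e, he⟩ := exists_binomialPolynomial_one_eq (F.hilbertFunction N - ∑ i, c i * N i) c
  refine ⟨binomialPolynomial 1 e, ⟨1, by simpa using hdim, e, rfl⟩,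
    eventually_atTop.mpr ⟨N, fun n hn => ?_⟩⟩
  rw [he, eq_affine_of_add_single (c := c) hN hn]
  simp only [mul_sub, Finset.sum_sub_distrib]
  ring

lemma span_prod_mul_ideal_eq_iff (hA : F.IsCompleteReduction A) {x : R}
    (hreg : x ∈ nonZeroDivisors R) (hx : ∀ i, x ∈ (I i).radical) (n : Fin s → ℤ) :
    columnProductIdeal A * F.ideal n = F.ideal (n + 1) ↔
      F.hilbertFunction (n + 1) =
        F.hilbertFunction n + ((Ring.ord R (∏ i, A i 0)).toNat : ℤ) := by
  have ha := F.prod_mem_nonZeroDivisors hA hreg hx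
  have hfin := F.length_quotient_ideal_ne_top hreg hx
  rw [columnProductIdeal_fin_one]
  unfold hilbertFunction
  rw [← Nat.cast_add, ← toNat_length_quotient_span_singleton_mul ha (hfin n), Nat.cast_inj]
  refine ⟨fun h => by rw [h], fun h => ?_⟩
  refine Ideal.eq_of_le_of_length_quotient_eq
    (F.span_prod_mul_ideal_le (fun i => hA.1 i 0) n) (hfin _) ?_
  -- Equality of `toNat` values gives equality of lengths only once both are finite.
  have hmul : Module.length R (R ⧸ Ideal.span {∏ i, A i 0} * F.ideal n) ≠ ⊤ := by
    rw [Ideal.length_quotient_span_singleton_mul ha]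
    exact WithTop.add_ne_top.mpr ⟨hfin n, Ring.ord_ne_top ha⟩
  rw [← ENat.natCast_toNat hmul, ← ENat.natCast_toNat (hfin (n + 1)), h]

lemma postulationVectors_subset_nonneg [IsLocalRing R] (hdim : ringKrullDim R = 1)
    (hF : ∀ n, F.ideal n = F.ideal (n ⊔ 0)) (hI : ∀ i, I i ≤ maximalIdeal R)
    (hA : F.IsCompleteReduction A) {x : R}
    (hreg : x ∈ nonZeroDivisors R) (hx : ∀ i, x ∈ (I i).radical) :
    F.postulationVectors ⊆ {n | 0 ≤ n} := by
  rintro n ⟨P, hP, hn⟩ i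
  by_contra! hi
  simp only [Pi.zero_apply] at hi
  have hslope := hP.add_eq F hdim (v := Pi.single i 1) (Pi.single_nonneg.mpr zero_le_one)
    ((F.eventually_hilbertFunction_add_single hA hreg hx).mono fun m hm => hm i)
  -- The coordinates -1 and 0 have the same positive part, so F(m) = F(m+eᵢ), while H = P at both
  -- points.
  let m := Function.update n i (-1)
  have hnm : n ≤ m := by
    intro j
    by_cases hj : j = i
    · subst hj
      simp only [m, Function.update_self]
      omega
    · simp [m, hj]
  have hideal : F.ideal (m + Pi.single i 1) = F.ideal m := by
    rw [hF (m + _), hF m]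
    congr 1
    funext j
    by_cases hj : j = i
    · subst hj
      simp [m]
    · simp [m, hj]
  have h := hslope m
  rw [← hn m hnm, ← hn (m + _) (hnm.trans (le_add_of_nonneg_right
    (Pi.single_nonneg.mpr zero_le_one))), hilbertFunction, hilbertFunction, hideal] at h
  have hord : (Ring.ord R (A i 0)).toNat = 0 := by omega
  have hdvd : A i 0 ∣ ∏ j, A j 0 := Finset.dvd_prod_of_mem _ (Finset.mem_univ i)
  -- This rules out `toNat` being 0 because the order is infinite; order 0 would then make aᵢ a
  -- unit.
  have hfin : Ring.ord R (A i 0) ≠ ⊤ := ((Ring.ord_le_ord_of_dvd hdvd).trans_lt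
    (Ring.ord_lt_top (F.prod_mem_nonZeroDivisors hA hreg hx))).ne
  have hzero : Ring.ord R (A i 0) = 0 := (ENat.toNat_eq_zero.mp hord).resolve_right hfin
  rw [Ring.ord, Module.length_eq_zero_iff, Ideal.Quotient.subsingleton_iff,
    Ideal.span_singleton_eq_top] at hzero
  exact (mem_maximalIdeal _).mp (hI i (hA.1 i 0)) hzero

lemma postulationVectors_eq_reductionVectors (hdim : ringKrullDim R = 1)
    (hpos : F.postulationVectors ⊆ {n | 0 ≤ n})
    (hA : F.IsCompleteReduction A) {x : R}
    (hreg : x ∈ nonZeroDivisors R) (hx : ∀ i, x ∈ (I i).radical) :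
    F.postulationVectors = F.reductionVectors A := by
  have hiff := F.span_prod_mul_ideal_eq_iff hA hreg hx
  have hev := hA.2.mono fun n => (hiff n).mp
  ext r
  constructor
  · intro hr
    obtain ⟨P, hP, hPr⟩ := id hr
    refine ⟨hpos hr, fun n hn => (hiff n).mpr ?_⟩
    rw [hPr n hn, hPr (n + 1) (hn.trans (le_add_of_nonneg_right zero_le_one)),
      hP.add_eq F hdim zero_le_one hev]
  · rintro ⟨-, hr⟩
    obtain ⟨P, hP⟩ := F.exists_isHilbertPolynomial hdim hA hreg hx
    refine ⟨P, hP, fun m hm => ?_⟩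
    have hstep (k : ℕ) : F.hilbertFunction m - P m =
        F.hilbertFunction (m + k • 1) - P (m + k • 1) := by
      induction k with
      | zero => simp
      | succ k ih =>
        have hle : r ≤ m + k • 1 := hm.trans (le_add_of_nonneg_right (nsmul_nonneg zero_le_one k))
        rw [ih, succ_nsmul, ← add_assoc, (hiff _).mp (hr _ hle),
          hP.add_eq F hdim zero_le_one hev]
        ring
    obtain ⟨N, hN⟩ := eventually_atTop.mp hP.2
    -- The sum bounds every deficit Nᵢ - mᵢ, so this many diagonal steps pass N in all coordinates.
    have hlarge : N ≤ m + (∑ i, (N i - m i).toNat) • (1 : Fin s → ℤ) := by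
      intro i
      have := Finset.single_le_sum (f := fun i => (N i - m i).toNat) (fun _ _ => Nat.zero_le _)
        (Finset.mem_univ i)
      simp only [Pi.add_apply, nsmul_eq_mul, mul_one, Pi.natCast_apply]
      omega
    have := hstep (∑ i, (N i - m i).toNat)
    rw [hN _ hlarge, sub_self] at this
    exact sub_eq_zero.mp this

end CompleteReduction

end MultiFiltration

theorem theorem5p1 {R : Type*} [CommRing R] [IsLocalRing R] [Infinite (ResidueField R)]
    (hCM : IsCohenMacaulayLocal R) (hdim : ringKrullDim R = 1)
    {s : ℕ} (hs : 1 ≤ s) (I : Fin s → Ideal R) (hI : ∀ i, (I i).radical = maximalIdeal R)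
    (F : MultiFiltration I) (hF : F.IsAdmissible)
    (A : Fin s → Fin 1 → R) (hA : F.IsCompleteReduction A) :
    F.postulationVectors ⊆ {n | 0 ≤ n} ∧
      F.postulationVectors = F.reductionVectors A ∧
      ∀ A' : Fin s → Fin 1 → R, F.IsCompleteReduction A' →
        F.reductionVectors A' = F.reductionVectors A := by
  have : IsNoetherianRing R := hCM.1
  have : Ring.KrullDimLE 1 R := ⟨by simpa [ringKrullDim] using hdim.le⟩
  obtain ⟨x, hxm, hreg⟩ := exists_mem_nonZeroDivisors_of_isCohenMacaulayLocal hCM hdim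
  have hx (i : Fin s) : x ∈ (I i).radical := hI i ▸ hxm
  have hpos := F.postulationVectors_subset_nonneg hdim hF.1
    (fun i => hI i ▸ Ideal.le_radical) hA hreg hx
  have heq (A' : Fin s → Fin 1 → R) (hA' : F.IsCompleteReduction A') :=
    F.postulationVectors_eq_reductionVectors hdim hpos hA' hreg hx
  exact ⟨hpos, heq A hA, fun A' hA' => (heq A' hA').symm.trans (heq A hA)⟩
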